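/- **Theorem (Stability).** For $\mathbf x\in\mathbb R^N$ and $S\subset[N]$ let $\mathbf x_S$ be the vector that agrees with $\mathbf x$ on $S$ and vanishes elsewhere, and let $\sigma_s(\mathbf x)_{\ell_1}=\inf\{\|\mathbf x-\mathbf z\|_1:\mathbf z\in\mathbb R^N \text{ has at most } s \text{ nonzero entries}\}$. Let $0\le\rho<1$, $\tau>0$, $c>0$, $d>0$. There is a constant $C>0$ depending only on $\rho,\tau,c,d$ such that the following holds. Let $L\ge 2$ and $\mathbf A\in\mathbb R^{M\times N}$, put $s=\lfloor cM/\log(eN/M)\rfloor$ and assume $s\ge 1$. Assume that $\mathbf A$ satisfies * the $\ell_2$-robust null space property of order $s$ with constants $\rho,\tau$: $\|\mathbf v_S\|_2\le \frac{\rho}{\sqrt s}\|\mathbf v_{S^c}\|_1+\tau\|\mathbf A\mathbf v\|_2$ for all $\mathbf v\in\mathbb R^N$ and all $S\subset[N]$ with $|S|\le s$; * the $\ell_1$-quotient property with constant $d$: for every $\mathbf b\in\mathbb R^M$ there is $\mathbf u\in\mathbb R^N$ with $\mathbf A\mathbf u=\mathbf b$ and $\|\mathbf u\|_1\le d\sqrt{M/\log(eN/M)}\,\|\mathbf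 b\|_2$. Let $\mathbf x_*\in\mathbb R^N$, $\mathbf y=\mathbf A\mathbf x_*$, and let $\mathbf y_+$ be the Euclidean projection of $\mathbf y$ onto $C_+=\{\mathbf A\mathbf z:\mathbf z\ge \mathbf 0\}$. Decompose $\mathbf x_*=\mathbf x_+-\mathbf x_-$ with $\mathbf x_+\ge\mathbf 0$ and $\mathbf A\mathbf x_+=\mathbf y_+$ (equivalently, $\mathbf x_+$ minimizes $\|\mathbf A\mathbf z-\mathbf y\|_2$ over $\mathbf z\ge\mathbf 0$). Let $\varepsilon>0$ and $0<\alpha\le h(\|\mathbf x_+\|_1,\varepsilon)$, where $$h(Q,\varepsilon)=\begin{cases}\min\Big(e^{-1/2},\ \exp\big(\tfrac12-\tfrac{Q^2+Ne^{-1}}{2\varepsilon}\big)\Big)& L=2,\\[1mm] \Big(\dfrac{2\varepsilon}{L(Q+N+\varepsilon)}\Big)^{1/(L-2)}& L>2.\end{cases}$$ Let $\mathbf x^{(1)},\dots,\mathbf x^{(L)}:[0,\infty)\to\mathbb R^N$ follow the gradient flow $(\mathbf x^{(k)})'(t)=-\nabla_{\mathbf x^{(k)}}\mathcal L(\mathbf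 x^{(1)}(t),\dots,\mathbf x^{(L)}(t))$, $\mathbf x^{(k)}(0)=\alpha\mathbf 1$ for all $k$, of the loss $\mathcal L(\mathbf x^{(1)},\dots,\mathbf x^{(L)})=\frac12\|\mathbf A(\mathbf x^{(1)}\odot\cdots\odot\mathbf x^{(L)})-\mathbf y\|_2^2$, where $\odot$ is the entrywise product. Then the limit $\tilde{\mathbf x}_\infty=\lim_{t\to\infty}\mathbf x^{(1)}(t)\odot\cdots\odot\mathbf x^{(L)}(t)$ exists and $$\|\tilde{\mathbf x}_\infty-\mathbf x_*\|_2\le\frac{C}{\sqrt s}\big(2\sigma_s(\mathbf x_+)_{\ell_1}+\varepsilon\big)+\|\mathbf x_-\|_2 .$$ -/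

import Mathlib

open Filter Topology

noncomputable section

/-- The product `A x`, for `x ∈ ℝ^N` and `A ∈ ℝ^{M × N}`, with values in Euclidean space. -/
def matVec {M N : ℕ} (A : Matrix (Fin M) (Fin N) ℝ) (x : EuclideanSpace ℝ (Fin N)) :
    EuclideanSpace ℝ (Fin M) :=
  WithLp.toLp 2 (A.mulVec x.ofLp)

/-- The `ℓ¹`-norm on `ℝ^N`. -/
def l1Norm {N : ℕ} (x : EuclideanSpace ℝ (Fin N)) : ℝ := ∑ i, |x i|

/-- The restriction `x_S`: the coordinates outside `S` are set to zero. -/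
def restrictTo {N : ℕ} (S : Finset (Fin N)) (x : EuclideanSpace ℝ (Fin N)) :
    EuclideanSpace ℝ (Fin N) :=
  WithLp.toLp 2 (fun i => if i ∈ S then x i else 0)

/-- `x` is `s`-sparse: it has at most `s` nonzero entries. -/
def IsSparse {N : ℕ} (s : ℕ) (x : EuclideanSpace ℝ (Fin N)) : Prop :=
  {i | x i ≠ 0}.ncard ≤ s

/-- The `ℓ¹`-error of the best `s`-term approximation of `x`. -/
def bestTermError {N : ℕ} (s : ℕ) (x : EuclideanSpace ℝ (Fin N)) : ℝ :=
  sInf {r | ∃ z : EuclideanSpace ℝ (Fin N), IsSparse s z ∧ r = l1Norm (x - z)}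

/-- The `ℓ²`-robust null space property of order `s` with constants `ρ` and `τ`. -/
def L2RobustNSP {M N : ℕ} (A : Matrix (Fin M) (Fin N) ℝ) (s : ℕ) (ρ τ : ℝ) : Prop :=
  ∀ S : Finset (Fin N), S.card ≤ s → ∀ v : EuclideanSpace ℝ (Fin N),
    ‖restrictTo S v‖ ≤ ρ / Real.sqrt s * l1Norm (restrictTo Sᶜ v) + τ * ‖matVec A v‖

/-- The scale `M / ln(eN/M)`. -/
def sparsityScale (M N : ℕ) : ℝ := (M : ℝ) / Real.log (Real.exp 1 * N / M)

/-- The `ℓ¹`-quotient property with constant `d` relative to the `ℓ²`-norm. -/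
def L1QuotientProperty {M N : ℕ} (A : Matrix (Fin M) (Fin N) ℝ) (d : ℝ) : Prop :=
  ∀ b : EuclideanSpace ℝ (Fin M), ∃ u : EuclideanSpace ℝ (Fin N),
    matVec A u = b ∧ l1Norm u ≤ d * Real.sqrt (sparsityScale M N) * ‖b‖

/-- The cone `C₊ = {A z : z ≥ 0}`. -/
def nonnegImage {M N : ℕ} (A : Matrix (Fin M) (Fin N) ℝ) : Set (EuclideanSpace ℝ (Fin M)) :=
  {w | ∃ z : EuclideanSpace ℝ (Fin N), (∀ i, 0 ≤ z i) ∧ w = matVec A z}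

/-- `p` is a Euclidean projection of `y` onto the set `K`, i.e. a nearest point of `K` to `y`. -/
def IsEuclideanProjection {M : ℕ} (K : Set (EuclideanSpace ℝ (Fin M)))
    (y p : EuclideanSpace ℝ (Fin M)) : Prop :=
  p ∈ K ∧ ∀ w ∈ K, ‖y - p‖ ≤ ‖y - w‖

/-- The entrywise product `x⁽¹⁾ ⊙ ⋯ ⊙ x⁽ᴸ⁾` of the factors. -/
def hadamardProd {N L : ℕ} (x : Fin L → EuclideanSpace ℝ (Fin N)) : EuclideanSpace ℝ (Fin N) :=
  WithLp.toLp 2 (fun i => ∏ k, x k i)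

/-- The overparametrized loss `½ ‖A (x⁽¹⁾ ⊙ ⋯ ⊙ x⁽ᴸ⁾) - y‖₂²`. -/
def overLoss {M N L : ℕ} (A : Matrix (Fin M) (Fin N) ℝ) (y : EuclideanSpace ℝ (Fin M))
    (x : Fin L → EuclideanSpace ℝ (Fin N)) : ℝ :=
  1 / 2 * ‖matVec A (hadamardProd x) - y‖ ^ 2

/-- The partial gradient of the overparametrized loss with respect to the `k`-th factor. -/
def partialGrad {M N L : ℕ} (A : Matrix (Fin M) (Fin N) ℝ) (y : EuclideanSpace ℝ (Fin M))
    (x : Fin L → EuclideanSpace ℝ (Fin N)) (k : Fin L) : EuclideanSpace ℝ (Fin N) :=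
  gradient (fun z => overLoss A y (Function.update x k z)) (x k)

/-- `x` follows, on `[0, ∞)`, the gradient flow of the overparametrized loss with all factors
initialized at `x₀` (the derivative at time `0` is one-sided). -/
def IsGradientFlow {M N L : ℕ} (A : Matrix (Fin M) (Fin N) ℝ) (y : EuclideanSpace ℝ (Fin M))
    (x₀ : EuclideanSpace ℝ (Fin N)) (x : ℝ → Fin L → EuclideanSpace ℝ (Fin N)) : Prop :=
  (∀ k, x 0 k = x₀) ∧
    ∀ k, ∀ t : ℝ, 0 ≤ t →
      HasDerivWithinAt (fun r => x r k) (-partialGrad A y (x t) k) (Set.Ici 0) t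

/-- The vector `α 1`. -/
def constVec (N : ℕ) (α : ℝ) : EuclideanSpace ℝ (Fin N) := WithLp.toLp 2 (fun _ => α)

/-- The threshold `h(Q, ε)` for the initialization magnitude, in dimension `N` with `L` factors
(meant for `L ≥ 2`). -/
def initThreshold (N L : ℕ) (Q ε : ℝ) : ℝ :=
  if L = 2 then
    min (Real.exp (-(1 / 2)))
      (Real.exp (1 / 2 - (Q ^ 2 + N * Real.exp (-1)) / (2 * ε)))
  else
    (2 * ε / (L * (Q + N + ε))) ^ (1 / ((L : ℝ) - 2))

end

/-! Equal positive initial values keep the factors equal, so the product is `u ^ L` entrywise, where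
`u' = -g u ^ (L-1)` and `g = Aᵀ(A u^L - y)`. This is a mirror flow: for a fixed `w ≥ 0` the
Bregman-type divergence `totalPotential L w u` has derivative `-⟨A u^L - y, A u^L - A w^L⟩`.

If `A w^L` equals the projection `p` of `y` onto the cone, the variational inequality for `p` bounds
this derivative by `-‖A u^L - p‖²`. Hence the divergence decreases, the flow stays bounded, and the
residual `A u^L - p` is small at arbitrarily late times. An accumulation point `v` of `u` along such
times satisfies `A v^L = p`; taking `v` as reference point gives convergence of the whole flow
(`IsReducedFlow.exists_limit`).

For two references with image `p` the derivatives agree, so the difference of their divergences is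
conserved. Comparing time `0` with infinity shows that `v` minimizes the divergence from the
starting point among all such references. For small `α` this divergence is, up to scaling and an
additive constant, the `ℓ¹`-norm of `w^L` plus a small correction, so the limit has almost minimal
`ℓ¹`-norm (`sum_le_of_totalPotential_two_le`, `sum_le_of_totalPotential_le`).

The limit and `xPos` have the same image under `A`, so the null space property turns the `ℓ¹` gap
into an `ℓ²` bound (`L2RobustNSP.norm_sub_le`); the triangle inequality adds `‖xNeg‖`. -/

/-! ### The gradient of the factorized loss -/

theorem matVec_apply {M N : ℕ} (A : Matrix (Fin M) (Fin N) ℝ) (x : EuclideanSpace ℝ (Fin N))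
    (m : Fin M) : matVec A x m = ∑ i, A m i * x i := rfl

/-- The matrix `A` as a continuous linear map between Euclidean spaces. -/
noncomputable def matVecCLM {M N : ℕ} (A : Matrix (Fin M) (Fin N) ℝ) :
    EuclideanSpace ℝ (Fin N) →L[ℝ] EuclideanSpace ℝ (Fin M) :=
  LinearMap.toContinuousLinearMap
    { toFun := matVec A
      map_add' := fun x y => by
        ext m; simp [matVec_apply, mul_add, Finset.sum_add_distrib]
      map_smul' := fun c x => by
        ext m; simp [matVec_apply, Finset.mul_sum, mul_left_comm] }

theorem matVecCLM_apply {M N : ℕ} (A : Matrix (Fin M) (Fin N) ℝ) (x : EuclideanSpace ℝ (Fin N)) :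
    matVecCLM A x = matVec A x := rfl

theorem matVec_sub {M N : ℕ} (A : Matrix (Fin M) (Fin N) ℝ) (x y : EuclideanSpace ℝ (Fin N)) :
    matVec A (x - y) = matVec A x - matVec A y := by
  simp only [← matVecCLM_apply, map_sub]

theorem continuous_matVec {M N : ℕ} (A : Matrix (Fin M) (Fin N) ℝ) : Continuous (matVec A) :=
  (matVecCLM A).continuous

/-- The gradient `Aᵀ (A x - y)` of the quadratic loss. -/
def residualGrad {M N : ℕ} (A : Matrix (Fin M) (Fin N) ℝ) (y : EuclideanSpace ℝ (Fin M))
    (x : EuclideanSpace ℝ (Fin N)) (i : Fin N) : ℝ :=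
  ∑ m, A m i * (matVec A x - y) m

theorem sum_residualGrad_mul {M N : ℕ} (A : Matrix (Fin M) (Fin N) ℝ)
    (y : EuclideanSpace ℝ (Fin M)) (x v : EuclideanSpace ℝ (Fin N)) :
    ∑ i, residualGrad A y x i * v i = inner ℝ (matVec A x - y) (matVec A v) := by
  simp only [residualGrad, PiLp.inner_apply, matVec_apply, Finset.sum_mul, RCLike.inner_apply,
    conj_trivial]
  rw [Finset.sum_comm]
  refine Finset.sum_congr rfl fun m _ => Finset.sum_congr rfl fun i _ => ?_
  ring

theorem continuous_residualGrad {M N : ℕ} (A : Matrix (Fin M) (Fin N) ℝ)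
    (y : EuclideanSpace ℝ (Fin M)) (i : Fin N) : Continuous fun x => residualGrad A y x i := by
  have := continuous_matVec A
  unfold residualGrad
  fun_prop

/-- Entrywise multiplication by a fixed vector, as a continuous linear map. -/
noncomputable def entrywiseMulCLM {N : ℕ} (P : Fin N → ℝ) :
    EuclideanSpace ℝ (Fin N) →L[ℝ] EuclideanSpace ℝ (Fin N) :=
  LinearMap.toContinuousLinearMap
    { toFun := fun z => WithLp.toLp 2 fun i => P i * z i
      map_add' := fun x y => by ext i; simp [mul_add]
      map_smul' := fun c x => by ext i; simp [mul_left_comm] }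

theorem entrywiseMulCLM_apply {N : ℕ} (P : Fin N → ℝ) (z : EuclideanSpace ℝ (Fin N)) (i : Fin N) :
    entrywiseMulCLM P z i = P i * z i := rfl

theorem hadamardProd_apply {N L : ℕ} (x : Fin L → EuclideanSpace ℝ (Fin N)) (i : Fin N) :
    hadamardProd x i = ∏ k, x k i := rfl

theorem hadamardProd_update {N L : ℕ} (x : Fin L → EuclideanSpace ℝ (Fin N)) (k : Fin L)
    (z : EuclideanSpace ℝ (Fin N)) :
    hadamardProd (Function.update x k z)
      = entrywiseMulCLM (fun i => ∏ j ∈ Finset.univ.erase k, x j i) z := by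
  ext i
  rw [hadamardProd_apply, entrywiseMulCLM_apply, ← Finset.mul_prod_erase _ _ (Finset.mem_univ k),
    mul_comm, Function.update_self]
  congr 1
  refine Finset.prod_congr rfl fun j hj => ?_
  rw [Function.update_of_ne (Finset.ne_of_mem_erase hj)]

theorem partialGrad_apply {M N L : ℕ} (A : Matrix (Fin M) (Fin N) ℝ)
    (y : EuclideanSpace ℝ (Fin M)) (x : Fin L → EuclideanSpace ℝ (Fin N)) (k : Fin L)
    (i : Fin N) :
    partialGrad A y x k i =
      residualGrad A y (hadamardProd x) i * ∏ j ∈ Finset.univ.erase k, x j i := by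
  set P : Fin N → ℝ := fun i => ∏ j ∈ Finset.univ.erase k, x j i with hP
  have hx : entrywiseMulCLM P (x k) = hadamardProd x := by
    rw [hP, ← hadamardProd_update, Function.update_eq_self]
  have h1 : HasFDerivAt (fun z => (matVecCLM A) (entrywiseMulCLM P z) - y)
      ((matVecCLM A).comp (entrywiseMulCLM P)) (x k) :=
    (((matVecCLM A).comp (entrywiseMulCLM P)).hasFDerivAt).sub_const y
  have h2 := (h1.norm_sq).const_mul (1 / 2 : ℝ)
  have h3 : HasGradientAt (fun z => overLoss A y (Function.update x k z))
      (WithLp.toLp 2 fun i => residualGrad A y (hadamardProd x) i * P i) (x k) := by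
    rw [hasGradientAt_iff_hasFDerivAt]
    simp only [overLoss, hadamardProd_update]
    refine h2.congr_fderiv ?_
    ext v
    simp only [_root_.smul_apply, ContinuousLinearMap.comp_apply, hx,
      InnerProductSpace.toDual_apply_apply, matVecCLM_apply, innerSL_apply_apply, smul_eq_mul]
    rw [← sum_residualGrad_mul, PiLp.inner_apply]
    simp only [entrywiseMulCLM_apply, RCLike.inner_apply, conj_trivial, Finset.mul_sum,
      nsmul_eq_mul]
    refine Finset.sum_congr rfl fun i _ => ?_
    push_cast
    ring
  rw [partialGrad, h3.gradient]

/-! ### Positivity and equality of the factors -/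

theorem IsGradientFlow.hasDerivWithinAt_coord {M N L : ℕ} {A : Matrix (Fin M) (Fin N) ℝ}
    {y : EuclideanSpace ℝ (Fin M)} {x₀ : EuclideanSpace ℝ (Fin N)}
    {x : ℝ → Fin L → EuclideanSpace ℝ (Fin N)} (h : IsGradientFlow A y x₀ x) (k : Fin L)
    (i : Fin N) {t : ℝ} (ht : 0 ≤ t) :
    HasDerivWithinAt (fun r => x r k i)
      (-(residualGrad A y (hadamardProd (x t)) i * ∏ j ∈ Finset.univ.erase k, x t j i))
      (Set.Ici 0) t := by
  have h1 := (EuclideanSpace.proj (𝕜 := ℝ) i).hasFDerivAt.comp_hasDerivWithinAt t (h.2 k t ht)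
  refine h1.congr_deriv ?_
  rw [← partialGrad_apply]
  rfl

/-- A solution of a differential inequality `|p'| ≤ K p` with `p 0 > 0` remains positive. -/
theorem pos_of_abs_deriv_le {p p' : ℝ → ℝ} {T K : ℝ} (hT : 0 ≤ T)
    (hp : ∀ t ∈ Set.Icc 0 T, HasDerivWithinAt p (p' t) (Set.Ici 0) t)
    (hle : ∀ t ∈ Set.Icc 0 T, |p' t| ≤ K * p t) (h0 : 0 < p 0) : 0 < p T := by
  -- With the integrating factor `exp (K t)`, the bound `p' ≥ -K p` makes the product nondecreasing.
  have hq : ∀ t ∈ Set.Icc 0 T, HasDerivWithinAt (fun t => p t * Real.exp (K * t))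
      (p' t * Real.exp (K * t) + p t * (Real.exp (K * t) * (K * 1))) (Set.Ici 0) t := by
    intro t ht
    exact (hp t ht).mul (((hasDerivWithinAt_id t _).const_mul K).exp)
  have hm : MonotoneOn (fun t => p t * Real.exp (K * t)) (Set.Icc 0 T) := by
    refine monotoneOn_of_hasDerivWithinAt_nonneg (convex_Icc 0 T)
      (fun t ht => ((hq t ht).continuousWithinAt).mono Set.Icc_subset_Ici_self)
      (fun t ht => (hq t (interior_subset ht)).mono
        (interior_subset.trans Set.Icc_subset_Ici_self)) fun t ht => ?_
    have h1 := neg_le_of_abs_le (hle t (interior_subset ht))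
    have h2 := Real.exp_pos (K * t)
    nlinarith
  have h3 := hm (Set.left_mem_Icc.2 hT) (Set.right_mem_Icc.2 hT) hT
  simp only [mul_zero, Real.exp_zero, mul_one] at h3
  exact pos_of_mul_pos_left (h0.trans_le h3) (Real.exp_pos _).le

/-- Identically initialized positive factors remain equal and positive along the flow. -/
theorem IsGradientFlow.pos_and_eq {M N L : ℕ} {A : Matrix (Fin M) (Fin N) ℝ}
    {y : EuclideanSpace ℝ (Fin M)} {α : ℝ} (hα : 0 < α) (hL : 2 ≤ L)
    {x : ℝ → Fin L → EuclideanSpace ℝ (Fin N)} (h : IsGradientFlow A y (constVec N α) x)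
    (i : Fin N) {t : ℝ} (ht : 0 ≤ t) :
    (∀ k, 0 < x t k i) ∧ ∀ k l, x t k i = x t l i := by
  have hc : ∀ k i, ContinuousOn (fun r => x r k i) (Set.Ici 0) := fun k i t ht =>
    (h.hasDerivWithinAt_coord k i ht).continuousWithinAt
  have hx0 : ∀ k, x 0 k i = α := fun k => by rw [h.1 k]; rfl
  have hprod : ∀ k t, x t k i * ∏ j ∈ Finset.univ.erase k, x t j i = hadamardProd (x t) i :=
    fun k t => by
      rw [hadamardProd_apply]
      exact Finset.mul_prod_erase Finset.univ (fun j => x t j i) (Finset.mem_univ k)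
  -- The derivative of the square does not depend on `k`: multiplying by the missing factor
  -- completes the product.
  have hsq : ∀ k, ∀ t, 0 ≤ t → HasDerivWithinAt (fun r => x r k i ^ 2)
      (-2 * residualGrad A y (hadamardProd (x t)) i * hadamardProd (x t) i) (Set.Ici 0) t := by
    intro k t ht
    refine ((h.hasDerivWithinAt_coord k i ht).pow 2).congr_deriv ?_
    rw [← hprod k t]; push_cast; ring
  have hsqeq : ∀ k l t, 0 ≤ t → x t k i ^ 2 = x t l i ^ 2 := by
    intro k l t ht
    have h1 : ∀ r ∈ Set.Icc 0 t, HasDerivWithinAt (fun r => x r k i ^ 2 - x r l i ^ 2) 0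
        (Set.Ici 0) r := fun r hr =>
      ((hsq k r hr.1).sub (hsq l r hr.1)).congr_deriv (sub_self _)
    have h2 := constant_of_has_deriv_right_zero
      (fun r hr => ((h1 r hr).continuousWithinAt).mono Set.Icc_subset_Ici_self)
      (fun r hr => (h1 r (Set.Ico_subset_Icc_self hr)).mono (Set.Ici_subset_Ici.2 hr.1)) t
      (Set.right_mem_Icc.2 ht)
    simp only [hx0] at h2
    linarith
  have habs : ∀ k l t, 0 ≤ t → |x t k i| = |x t l i| := fun k l t ht =>
    (sq_eq_sq_iff_abs_eq_abs _ _).1 (hsqeq k l t ht)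
  have hcp : ContinuousOn (fun r => hadamardProd (x r)) (Set.Ici 0) := by
    rw [show (fun r => hadamardProd (x r)) = fun r => WithLp.toLp 2 (fun i => ∏ k, x r k i)
      from rfl]
    refine (PiLp.continuous_toLp 2 _).comp_continuousOn (continuousOn_pi.2 fun i => ?_)
    exact continuousOn_finsetProd _ fun k _ => hc k i
  have hpos : ∀ k t, 0 ≤ t → 0 < x t k i ^ 2 := by
    intro k T hT
    -- Since `L ≥ 2`, the full product contains the square of the factor; what remains is
    -- continuous, hence bounded on `[0, T]`, and serves as the rate `K`.
    have hcont : ContinuousOn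
        (fun r => 2 * |residualGrad A y (hadamardProd (x r)) i| * |x r k i| ^ (L - 2))
        (Set.Icc 0 T) :=
      ((continuousOn_const.mul (((continuous_residualGrad A y i).comp_continuousOn hcp).abs)).mul
        ((hc k i).abs.pow _)).mono Set.Icc_subset_Ici_self
    obtain ⟨K, hK⟩ := isCompact_Icc.bddAbove_image hcont
    refine pos_of_abs_deriv_le (p := fun r => x r k i ^ 2) (K := K) hT (fun t ht => hsq k t ht.1) (fun t ht => ?_)
      (by simp only [hx0]; positivity)
    have h1 := hK (Set.mem_image_of_mem _ ht)
    have h2 : |hadamardProd (x t) i| = |x t k i| ^ (L - 2) * x t k i ^ 2 := by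
      rw [hadamardProd_apply, Finset.abs_prod, Finset.prod_congr rfl fun l _ => habs l k t ht.1,
        Finset.prod_const, Finset.card_univ, Fintype.card_fin, ← sq_abs (x t k i), ← pow_add]
      congr 1; omega
    rw [abs_mul, abs_mul, h2, ← mul_assoc, abs_neg, abs_two]
    exact mul_le_mul_of_nonneg_right h1 (sq_nonneg _)
  have hposx : ∀ k, 0 < x t k i := by
    intro k
    by_contra hneg
    have h0 : (0 : ℝ) ∈ Set.Icc (x t k i) (x 0 k i) := ⟨not_lt.1 hneg, by rw [hx0]; exact hα.le⟩
    obtain ⟨r, hr, hr0⟩ := intermediate_value_Icc' ht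
      ((hc k i).mono Set.Icc_subset_Ici_self) h0
    have := hpos k r hr.1
    simp only at hr0
    rw [hr0] at this
    norm_num at this
  refine ⟨hposx, fun k l => ?_⟩
  have := habs k l t ht
  rwa [abs_of_pos (hposx k), abs_of_pos (hposx l)] at this

/-! ### The Bregman potential -/

/-- An antiderivative of `-u ^ (1 - L)` on the positive half-line. -/
noncomputable def barrier (L : ℕ) (u : ℝ) : ℝ :=
  if L = 2 then -Real.log u else (u ^ (L - 2))⁻¹ / ((L : ℝ) - 2)

/-- The Bregman divergence of `w ^ L` and `u ^ L` for the mirror map of depth `L`, up to a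
constant factor. -/
noncomputable def potential (L : ℕ) (w u : ℝ) : ℝ :=
  (u ^ 2 - w ^ 2) / 2 + w ^ L * (barrier L u - barrier L w)

theorem hasDerivAt_barrier {L : ℕ} (hL : 2 ≤ L) {u : ℝ} (hu : 0 < u) :
    HasDerivAt (barrier L) (-(u ^ (L - 1))⁻¹) u := by
  obtain rfl | ⟨n, rfl⟩ : L = 2 ∨ ∃ n, L = n + 3 := by
    rcases hL.eq_or_lt with h | h
    · exact Or.inl h.symm
    · exact Or.inr ⟨L - 3, by omega⟩
  · have : barrier 2 = fun u => -Real.log u := by ext; simp [barrier]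
    rw [this]
    simpa using! (Real.hasDerivAt_log hu.ne').neg
  · have h : barrier (n + 3) = fun u => (u ^ (n + 1))⁻¹ / ((n : ℝ) + 1) := by
      ext v
      rw [barrier, if_neg (by omega), show n + 3 - 2 = n + 1 by omega]
      push_cast; ring
    rw [h]
    refine ((((hasDerivAt_pow (n + 1) u).inv (by positivity))).div_const _).congr_deriv ?_
    rw [show n + 3 - 1 = n + 2 by omega, show n + 1 - 1 = n by omega]
    have : (n : ℝ) + 1 ≠ 0 := by positivity
    push_cast
    field_simp
    ring

/-- The potential is built for this derivative: multiplied by `u' = -g u ^ (L-1)` it gives `-g (u ^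
L - w ^ L)`, which is linear in the product variable. -/
theorem hasDerivAt_potential {L : ℕ} (hL : 2 ≤ L) (w : ℝ) {u : ℝ} (hu : 0 < u) :
    HasDerivAt (potential L w) (u - w ^ L * (u ^ (L - 1))⁻¹) u := by
  have h1 := (((hasDerivAt_pow 2 u).sub_const (w ^ 2)).div_const 2).add
    (((hasDerivAt_barrier hL hu).sub_const (barrier L w)).const_mul (w ^ L))
  refine h1.congr_deriv ?_
  norm_num
  ring

/-- The barrier is convex with slope `-w ^ (1-L)` at `w`, so its tangent line there gives the bound.
The tangent inequality is `log t ≤ t - 1` for `L = 2` and Bernoulli's inequality for `L > 2`. This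
coercivity yields boundedness and, later, convergence. -/
theorem sq_sub_le_potential {L : ℕ} (hL : 2 ≤ L) {w u : ℝ} (hw : 0 ≤ w) (hu : 0 < u) :
    (u - w) ^ 2 / 2 ≤ potential L w u := by
  rcases hw.eq_or_lt with rfl | hw
  · simp [potential, show L ≠ 0 by omega]
  suffices h : -(w * (u - w)) ≤ w ^ L * (barrier L u - barrier L w) by
    rw [potential]; nlinarith
  obtain rfl | ⟨n, rfl⟩ : L = 2 ∨ ∃ n, L = n + 3 := by
    rcases hL.eq_or_lt with h | h
    · exact Or.inl h.symm
    · exact Or.inr ⟨L - 3, by omega⟩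
  · have h1 := Real.log_le_sub_one_of_pos (div_pos hu hw)
    rw [Real.log_div hu.ne' hw.ne'] at h1
    have h2 := mul_le_mul_of_nonneg_left h1 (sq_nonneg w)
    have h3 : w ^ 2 * (u / w - 1) = w * (u - w) := by field_simp
    simp only [barrier, if_true]
    linarith
  · have h1 := one_add_mul_le_pow (a := w / u - 1)
      (by have := div_pos hw hu; linarith) (n + 1)
    have h2 : w ^ (n + 3) * (barrier (n + 3) u - barrier (n + 3) w)
        = w ^ 2 * (((w / u) ^ (n + 1) - 1) / ((n : ℝ) + 1)) := by
      have hn : (n : ℝ) + 1 ≠ 0 := by positivity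
      rw [barrier, barrier, if_neg (by omega), show n + 3 - 2 = n + 1 by omega]
      push_cast
      rw [show (n : ℝ) + 3 - 2 = n + 1 by ring, div_pow]
      field_simp
      ring
    have h3 : 1 - u / w ≤ w / u - 1 := by
      have h4 : w / u - 1 - (1 - u / w) = (w - u) ^ 2 / (w * u) := by field_simp
      have h5 : 0 ≤ (w - u) ^ 2 / (w * u) := by positivity
      linarith
    have h6 : w / u - 1 ≤ ((w / u) ^ (n + 1) - 1) / ((n : ℝ) + 1) := by
      rw [le_div_iff₀ (by positivity)]
      push_cast at h1
      simp only [add_sub_cancel] at h1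
      linarith
    rw [h2]
    have h7 := mul_le_mul_of_nonneg_left (h3.trans h6) (sq_nonneg w)
    have h8 : w ^ 2 * (1 - u / w) = -(w * (u - w)) := by field_simp; ring
    linarith

theorem potential_self (L : ℕ) (w : ℝ) : potential L w w = 0 := by simp [potential]

/-- The limit `w = 0` needs its own case, since the barrier blows up there; its coefficient `w ^ L`
vanishes and only `u ^ 2 / 2` remains. -/
theorem tendsto_potential_self {ι : Type*} {l : Filter ι} {L : ℕ} (hL : 2 ≤ L) {w : ℝ}
    (hw : 0 ≤ w) {v : ι → ℝ} (hv : Tendsto v l (𝓝 w)) :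
    Tendsto (fun n => potential L w (v n)) l (𝓝 0) := by
  rcases hw.eq_or_lt with rfl | hw
  · have := ((hv.pow 2).div_const 2)
    simpa [potential, show L ≠ 0 by omega] using this
  · rw [← potential_self L w]
    exact (hasDerivAt_potential hL w hw).continuousAt.tendsto.comp hv

/-- The entrywise power `w ↦ w ^ L`. -/
def powVec {N : ℕ} (L : ℕ) (w : Fin N → ℝ) : EuclideanSpace ℝ (Fin N) :=
  WithLp.toLp 2 fun i => w i ^ L

theorem continuous_powVec {N : ℕ} (L : ℕ) : Continuous (powVec (N := N) L) :=
  (PiLp.continuous_toLp 2 _).comp (by fun_prop)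

theorem exists_powVec_eq {N L : ℕ} (hL : 2 ≤ L) {z : EuclideanSpace ℝ (Fin N)}
    (hz : ∀ i, 0 ≤ z i) : ∃ w : Fin N → ℝ, (∀ i, 0 ≤ w i) ∧ powVec L w = z := by
  refine ⟨fun i => z i ^ ((L : ℝ)⁻¹), fun i => Real.rpow_nonneg (hz i) _, ?_⟩
  ext i
  exact Real.rpow_inv_natCast_pow (hz i) (by omega)

/-- The sum of the coordinatewise potentials. -/
noncomputable def totalPotential {N : ℕ} (L : ℕ) (w u : Fin N → ℝ) : ℝ :=
  ∑ i, potential L (w i) (u i)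

theorem totalPotential_nonneg {N L : ℕ} (hL : 2 ≤ L) {w u : Fin N → ℝ} (hw : ∀ i, 0 ≤ w i)
    (hu : ∀ i, 0 < u i) : 0 ≤ totalPotential L w u :=
  Finset.sum_nonneg fun i _ => le_trans (by positivity) (sq_sub_le_potential hL (hw i) (hu i))

theorem sq_sub_le_totalPotential {N L : ℕ} (hL : 2 ≤ L) {w u : Fin N → ℝ} (hw : ∀ i, 0 ≤ w i)
    (hu : ∀ i, 0 < u i) (i : Fin N) : (u i - w i) ^ 2 / 2 ≤ totalPotential L w u :=
  (sq_sub_le_potential hL (hw i) (hu i)).trans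
    (Finset.single_le_sum (f := fun i => potential L (w i) (u i))
      (fun i _ => le_trans (by positivity) (sq_sub_le_potential hL (hw i) (hu i)))
      (Finset.mem_univ i))

/-! ### Projection onto the cone and convergence of the reduced flow -/

theorem convex_nonnegImage {M N : ℕ} (A : Matrix (Fin M) (Fin N) ℝ) :
    Convex ℝ (nonnegImage A) := by
  rintro _ ⟨z, hz, rfl⟩ _ ⟨z', hz', rfl⟩ a b ha hb _
  refine ⟨a • z + b • z', fun i => ?_, ?_⟩
  · have h1 := mul_nonneg ha (hz i)
    have h2 := mul_nonneg hb (hz' i)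
    simpa using add_nonneg h1 h2
  · simp only [← matVecCLM_apply, map_add, map_smul]

theorem IsEuclideanProjection.inner_le_zero {M : ℕ} {K : Set (EuclideanSpace ℝ (Fin M))}
    (hK : Convex ℝ K) {y p : EuclideanSpace ℝ (Fin M)} (h : IsEuclideanProjection K y p)
    {q : EuclideanSpace ℝ (Fin M)} (hq : q ∈ K) : inner ℝ (y - p) (q - p) ≤ 0 := by
  refine (norm_eq_iInf_iff_real_inner_le_zero hK h.1).1 ?_ q hq
  have : Nonempty K := ⟨⟨p, h.1⟩⟩
  refine le_antisymm (le_ciInf fun w => h.2 w w.2) ?_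
  exact ciInf_le (f := fun w : K => ‖y - w‖)
    ⟨0, by rintro _ ⟨w, rfl⟩; exact norm_nonneg _⟩ ⟨p, h.1⟩

/-- `u` solves the scalar-factor flow obtained from equal, positive factors. -/
structure IsReducedFlow {M N : ℕ} (L : ℕ) (A : Matrix (Fin M) (Fin N) ℝ)
    (y : EuclideanSpace ℝ (Fin M)) (u : ℝ → Fin N → ℝ) : Prop where
  pos : ∀ t, 0 ≤ t → ∀ i, 0 < u t i
  deriv : ∀ t, 0 ≤ t → ∀ i, HasDerivWithinAt (fun r => u r i)
    (-(residualGrad A y (powVec L (u t)) i * u t i ^ (L - 1))) (Set.Ici 0) t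

namespace IsReducedFlow

variable {M N L : ℕ} {A : Matrix (Fin M) (Fin N) ℝ} {y : EuclideanSpace ℝ (Fin M)}
  {u : ℝ → Fin N → ℝ}

theorem hasDerivWithinAt_totalPotential (hu : IsReducedFlow L A y u) (hL : 2 ≤ L)
    (w : Fin N → ℝ) {t : ℝ} (ht : 0 ≤ t) :
    HasDerivWithinAt (fun r => totalPotential L w (u r))
      (-inner ℝ (matVec A (powVec L (u t)) - y)
        (matVec A (powVec L (u t)) - matVec A (powVec L w))) (Set.Ici 0) t := by
  have h1 : HasDerivWithinAt (fun r => totalPotential L w (u r))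
      (∑ i, (u t i - w i ^ L * (u t i ^ (L - 1))⁻¹) *
        -(residualGrad A y (powVec L (u t)) i * u t i ^ (L - 1))) (Set.Ici 0) t :=
    HasDerivWithinAt.fun_sum fun i _ =>
      HasDerivAt.comp_hasDerivWithinAt (h₂ := potential L (w i)) (h := fun r => u r i) t
        (hasDerivAt_potential hL (w i) (hu.pos t ht i)) (hu.deriv t ht i)
  refine h1.congr_deriv ?_
  rw [← matVec_sub, ← sum_residualGrad_mul, ← Finset.sum_neg_distrib]
  refine Finset.sum_congr rfl fun i _ => ?_
  have h2 := (hu.pos t ht i).ne'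
  have h3 : u t i ^ L = u t i * u t i ^ (L - 1) := by
    rw [← pow_succ']; congr 1; omega
  simp only [PiLp.sub_apply, powVec, h3]
  field_simp

/-- Write `q - y = (q - p) - (y - p)`; the projection makes an obtuse angle, `⟨y - p, q - p⟩ ≤ 0`,
for every `q` in the cone. -/
theorem norm_sq_le_inner (hu : IsReducedFlow L A y u) {p : EuclideanSpace ℝ (Fin M)}
    (hp : IsEuclideanProjection (nonnegImage A) y p) {t : ℝ} (ht : 0 ≤ t) :
    ‖matVec A (powVec L (u t)) - p‖ ^ 2 ≤
      inner ℝ (matVec A (powVec L (u t)) - y) (matVec A (powVec L (u t)) - p) := by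
  set q := matVec A (powVec L (u t)) with hq
  have h1 := hp.inner_le_zero (convex_nonnegImage A) (q := q)
    ⟨_, fun i => pow_nonneg (hu.pos t ht i).le L, hq⟩
  rw [← real_inner_self_eq_norm_sq, show q - y = (q - p) - (y - p) by abel,
    inner_sub_left (q - p) (y - p)]
  linarith

theorem antitoneOn_totalPotential_add (hu : IsReducedFlow L A y u) (hL : 2 ≤ L)
    {p : EuclideanSpace ℝ (Fin M)} {w : Fin N → ℝ} (hw : matVec A (powVec L w) = p) {δ T : ℝ}
    (hT : 0 ≤ T) (hδ : ∀ t, T ≤ t → δ ≤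
      inner ℝ (matVec A (powVec L (u t)) - y) (matVec A (powVec L (u t)) - p)) :
    AntitoneOn (fun t => totalPotential L w (u t) + δ * t) (Set.Ici T) := by
  have hd : ∀ t ∈ Set.Ici T, HasDerivWithinAt (fun r => totalPotential L w (u r) + δ * r)
      (-inner ℝ (matVec A (powVec L (u t)) - y) (matVec A (powVec L (u t)) - p) + δ * 1)
      (Set.Ici T) t := fun t ht => by
    have h1 := hu.hasDerivWithinAt_totalPotential hL w (hT.trans ht)
    rw [hw] at h1
    exact (h1.mono (Set.Ici_subset_Ici.2 hT)).add ((hasDerivWithinAt_id t _).const_mul δ)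
  refine antitoneOn_of_hasDerivWithinAt_nonpos (convex_Ici T)
    (fun t ht => (hd t ht).continuousWithinAt)
    (fun t ht => (hd t (interior_subset ht)).mono interior_subset) fun t ht => ?_
  have := hδ t (interior_subset ht)
  linarith

theorem antitoneOn_totalPotential (hu : IsReducedFlow L A y u) (hL : 2 ≤ L)
    {p : EuclideanSpace ℝ (Fin M)} (hp : IsEuclideanProjection (nonnegImage A) y p)
    {w : Fin N → ℝ} (hw : matVec A (powVec L w) = p) :
    AntitoneOn (fun t => totalPotential L w (u t)) (Set.Ici 0) := by
  simpa using hu.antitoneOn_totalPotential_add hL hw (δ := 0) le_rfl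
    fun t ht => (sq_nonneg _).trans (hu.norm_sq_le_inner hp ht)

/-- Otherwise the potential would fall at rate at least `δ` forever and become negative. -/
theorem exists_norm_sq_lt (hu : IsReducedFlow L A y u) (hL : 2 ≤ L)
    {p : EuclideanSpace ℝ (Fin M)} (hp : IsEuclideanProjection (nonnegImage A) y p)
    {δ T : ℝ} (hδ : 0 < δ) (hT : 0 ≤ T) :
    ∃ t, T ≤ t ∧ ‖matVec A (powVec L (u t)) - p‖ ^ 2 < δ := by
  by_contra! hcon
  obtain ⟨z, hz, hpz⟩ := hp.1
  obtain ⟨w, hw, rfl⟩ := exists_powVec_eq hL hz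
  have h1 := hu.antitoneOn_totalPotential_add hL hpz.symm hT
    fun t ht => (hcon t ht).trans (hu.norm_sq_le_inner hp (hT.trans ht))
  have h0 := totalPotential_nonneg hL hw (hu.pos T hT)
  set E := totalPotential L w (u T)
  have hle : T ≤ T + (E + 1) / δ := by
    have : 0 ≤ (E + 1) / δ := by positivity
    linarith
  have h2 := h1 (Set.self_mem_Ici) hle hle
  have h3 := totalPotential_nonneg hL hw (hu.pos _ (hT.trans hle))
  have h4 : δ * (T + (E + 1) / δ) = δ * T + (E + 1) := by field_simp
  simp only [h4] at h2
  linarith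

/-- The reduced flow converges, and its limit minimizes the initial potential among the
nonnegative solutions of the projected linear system. -/
theorem exists_limit (hu : IsReducedFlow L A y u) (hL : 2 ≤ L)
    {p : EuclideanSpace ℝ (Fin M)} (hp : IsEuclideanProjection (nonnegImage A) y p) :
    ∃ v : Fin N → ℝ, (∀ i, 0 ≤ v i) ∧ Tendsto u atTop (𝓝 v) ∧ matVec A (powVec L v) = p ∧
      ∀ w : Fin N → ℝ, (∀ i, 0 ≤ w i) → matVec A (powVec L w) = p →
        totalPotential L v (u 0) ≤ totalPotential L w (u 0) := by
  -- Late times with vanishing residual; only along these is the image of an accumulation point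
  -- known to be `p`.
  choose t ht ht' using fun n : ℕ => hu.exists_norm_sq_lt hL hp
    (δ := 1 / ((n : ℝ) + 1)) (T := n) (by positivity) (by positivity)
  have ht0 : ∀ n, 0 ≤ t n := fun n => (Nat.cast_nonneg n).trans (ht n)
  have htop : Tendsto t atTop atTop := tendsto_atTop_mono ht tendsto_natCast_atTop_atTop
  have hbdd : Bornology.IsBounded (u '' Set.Ici 0) := by
    obtain ⟨z, hz, hpz⟩ := hp.1
    obtain ⟨w, hw, rfl⟩ := exists_powVec_eq hL hz
    refine (Metric.isBounded_iff_subset_closedBall w).2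
      ⟨Real.sqrt (2 * totalPotential L w (u 0)), ?_⟩
    rintro _ ⟨r, hr, rfl⟩
    rw [Metric.mem_closedBall, dist_pi_le_iff (Real.sqrt_nonneg _)]
    intro i
    rw [Real.dist_eq]
    refine Real.abs_le_sqrt ?_
    have h1 := sq_sub_le_totalPotential hL hw (hu.pos r hr) i
    have h2 := hu.antitoneOn_totalPotential hL hp hpz.symm Set.self_mem_Ici hr hr
    simp only at h2
    linarith
  obtain ⟨v, -, φ, hφ, hv⟩ := tendsto_subseq_of_bounded hbdd
    (x := fun n => u (t n)) fun n => Set.mem_image_of_mem u (ht0 n)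
  have hv0 : ∀ i, 0 ≤ v i := fun i =>
    ge_of_tendsto' ((continuous_apply i).continuousAt.tendsto.comp hv)
      fun n => (hu.pos _ (ht0 _) i).le
  have hAv : matVec A (powVec L v) = p := by
    have h1 : Tendsto (fun n => ‖matVec A (powVec L (u (t (φ n)))) - p‖ ^ 2) atTop
        (𝓝 (‖matVec A (powVec L v) - p‖ ^ 2)) :=
      (((((continuous_matVec A).comp (continuous_powVec L)).sub
        continuous_const).norm.pow 2).tendsto v).comp hv
    have h2 : Tendsto (fun n => ‖matVec A (powVec L (u (t (φ n)))) - p‖ ^ 2) atTop (𝓝 0) :=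
      squeeze_zero (fun n => sq_nonneg _) (fun n => (ht' (φ n)).le)
        (tendsto_one_div_add_atTop_nhds_zero_nat.comp hφ.tendsto_atTop)
    have h3 := tendsto_nhds_unique h1 h2
    rwa [sq_eq_zero_iff, norm_eq_zero, sub_eq_zero] at h3
  -- The potential relative to `v` tends to zero along the subsequence, and monotonicity extends
  -- this to all times.
  have hE : Tendsto (fun r => totalPotential L v (u r)) atTop (𝓝 0) := by
    have h1 : Tendsto (fun n => totalPotential L v (u (t (φ n)))) atTop (𝓝 0) := by
      have := tendsto_finsetSum Finset.univ fun (i : Fin N) _ =>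
        tendsto_potential_self hL (hv0 i) (tendsto_pi_nhds.1 hv i)
      simpa [totalPotential] using this
    rw [Metric.tendsto_atTop]
    intro ε hε
    obtain ⟨n, hn⟩ := (h1.eventually (gt_mem_nhds hε)).exists
    refine ⟨t (φ n), fun r hr => ?_⟩
    have hr0 := (ht0 (φ n)).trans hr
    rw [Real.dist_0_eq_abs, abs_of_nonneg (totalPotential_nonneg hL hv0 (hu.pos r hr0))]
    exact (hu.antitoneOn_totalPotential hL hp hAv (ht0 _) hr0 hr).trans_lt hn
  refine ⟨v, hv0, ?_, hAv, fun w hw hAw => ?_⟩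
  · rw [tendsto_pi_nhds]
    intro i
    have h1 : Tendsto (fun r => (u r i - v i) ^ 2) atTop (𝓝 0) := by
      refine squeeze_zero' (Eventually.of_forall fun r => sq_nonneg _) ?_
        (by simpa using hE.const_mul 2)
      filter_upwards [eventually_ge_atTop 0] with r hr
      have := sq_sub_le_totalPotential hL hv0 (hu.pos r hr) i
      linarith
    have h2 := h1.sqrt
    simp only [Real.sqrt_sq_eq_abs, Real.sqrt_zero] at h2
    exact tendsto_sub_nhds_zero_iff.1 ((tendsto_zero_iff_abs_tendsto_zero _).2 h2)
  -- The two derivatives depend on the reference only through its image `p`, so they cancel.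
  · have hd : ∀ r ∈ Set.Ici (0 : ℝ), HasDerivWithinAt
        (fun r => totalPotential L w (u r) - totalPotential L v (u r)) 0 (Set.Ici 0) r :=
      fun r hr => by
        have h1 := (hu.hasDerivWithinAt_totalPotential hL w hr).sub
          (hu.hasDerivWithinAt_totalPotential hL v hr)
        rwa [hAw, hAv, sub_self] at h1
    have hanti := antitoneOn_of_hasDerivWithinAt_nonpos (convex_Ici (0 : ℝ))
      (fun r hr => (hd r hr).continuousWithinAt)
      (fun r hr => (hd r (interior_subset hr)).mono interior_subset) fun r _ => le_rfl
    have h2 : Tendsto (fun r => -totalPotential L v (u r)) atTop (𝓝 0) := by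
      simpa using hE.neg
    have h3 : 0 ≤ totalPotential L w (u 0) - totalPotential L v (u 0) := by
      refine le_of_tendsto h2 ?_
      filter_upwards [eventually_ge_atTop 0] with r hr
      have h4 := hanti Set.self_mem_Ici hr hr
      have h5 := totalPotential_nonneg hL hw (hu.pos r hr)
      simp only at h4
      linarith
    linarith

end IsReducedFlow

/-! ### Almost minimal `ℓ¹`-norm of the limit -/

/-- Twice the potential is the weight `-1 - 2 log α` times the `ℓ¹`-norm, plus an entropy term and a
constant. The threshold makes the weight large enough to dominate the entropy. -/
theorem sum_le_of_totalPotential_two_le {N : ℕ} {w v : Fin N → ℝ} {ε α : ℝ}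
    (hε : 0 < ε) (hα : 0 < α) (h : α ≤ initThreshold N 2 (∑ i, w i ^ 2) ε)
    (hle : totalPotential 2 v (fun _ => α) ≤ totalPotential 2 w (fun _ => α)) :
    ∑ i, v i ^ 2 ≤ ∑ i, w i ^ 2 + 11 * ε := by
  have hpot : ∀ z : Fin N → ℝ, 2 * totalPotential 2 z (fun _ => α) =
      N * α ^ 2 + ∑ i, z i ^ 2 * Real.log (z i ^ 2)
        + (-1 - 2 * Real.log α) * ∑ i, z i ^ 2 := by
    intro z
    have hc : (N : ℝ) * α ^ 2 = ∑ _i : Fin N, α ^ 2 := by simp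
    rw [hc, totalPotential, Finset.mul_sum, Finset.mul_sum, ← Finset.sum_add_distrib,
      ← Finset.sum_add_distrib]
    refine Finset.sum_congr rfl fun i _ => ?_
    simp only [potential, barrier, if_true, Real.log_pow]
    push_cast
    ring
  have h1 : (∑ i, v i ^ 2 * Real.log (v i ^ 2)) + (-1 - 2 * Real.log α) * ∑ i, v i ^ 2
      ≤ (∑ i, w i ^ 2 * Real.log (w i ^ 2)) + (-1 - 2 * Real.log α) * ∑ i, w i ^ 2 := by
    have := hpot v; have := hpot w; linarith
  rw [initThreshold, if_pos rfl, le_min_iff] at h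
  have hl1 := (Real.log_le_iff_le_exp hα).2 h.1
  have hl2 := (Real.log_le_iff_le_exp hα).2 h.2
  set Q := ∑ i, w i ^ 2 with hQ
  have hQ0 : 0 ≤ Q := Finset.sum_nonneg fun i _ => sq_nonneg _
  have hV0 : 0 ≤ ∑ i, v i ^ 2 := Finset.sum_nonneg fun i _ => sq_nonneg _
  have hwlog : (∑ i, w i ^ 2 * Real.log (w i ^ 2)) ≤ Q ^ 2 := by
    calc (∑ i, w i ^ 2 * Real.log (w i ^ 2)) ≤ ∑ i, w i ^ 2 * Q := by
          refine Finset.sum_le_sum fun i _ => mul_le_mul_of_nonneg_left ?_ (sq_nonneg _)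
          refine (Real.log_le_self (sq_nonneg _)).trans ?_
          exact Finset.single_le_sum (f := fun i => w i ^ 2) (fun i _ => sq_nonneg _)
            (Finset.mem_univ i)
      _ = Q ^ 2 := by rw [← Finset.sum_mul, sq]
  have hcard : ∀ κ : ℝ, ∑ _i : Fin N, κ = N * κ := fun κ => by simp
  -- the tangent line of `x log x` at `x = e ^ κ`
  have htan : ∀ κ x : ℝ, 0 ≤ x → (κ + 1) * x - Real.exp κ ≤ x * Real.log x := by
    intro κ x hx
    rcases hx.eq_or_lt with rfl | hx
    · simp [Real.exp_nonneg]
    · have h2 := Real.add_one_le_exp (κ - Real.log x)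
      rw [Real.exp_sub, Real.exp_log hx, le_div_iff₀ hx] at h2
      linarith
  have hvlog : ∀ κ : ℝ, (κ + 1) * ∑ i, v i ^ 2 - N * Real.exp κ
      ≤ ∑ i, v i ^ 2 * Real.log (v i ^ 2) := by
    intro κ
    rw [Finset.mul_sum, ← hcard, ← Finset.sum_sub_distrib]
    exact Finset.sum_le_sum fun i _ => htan κ _ (sq_nonneg _)
  have hN : (0 : ℝ) ≤ N := Nat.cast_nonneg N
  set V := ∑ i, v i ^ 2
  set a := -1 - 2 * Real.log α with ha
  have ha0 : 0 ≤ a := by linarith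
  have he : Real.exp (-1) * Real.exp 1 = 1 := by rw [← Real.exp_add]; simp
  have he1 := Real.exp_one_lt_d9
  have he0 := Real.exp_pos (-1)
  set B := Q ^ 2 + N * Real.exp (-1) with hB
  have hB0 : 0 ≤ B := by positivity
  by_contra! hcon
  have haB : B / ε - 2 ≤ a := by
    have : B / (2 * ε) = B / ε / 2 := by field_simp
    rw [this] at hl2
    linarith
  -- For `B ≥ 4ε` the weight is at least `B / (2ε)`, and the entropy bound `-1/e` gives `a (V - Q) ≤
  -- B`, so `V - Q ≤ 2ε`. For `B < 4ε` only `a ≥ 0` is kept, and `x - 1 ≤ x log x` gives `V ≤ Q ^ 2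
  -- + N ≤ e B < 4e ε`. The constant `11` comes from `4e < 11`.
  by_cases hcase : 4 * ε ≤ B
  · have h2 := hvlog (-1)
    have h3 : a * (V - Q) ≤ B := by linarith
    have h4 : B / ε / 2 ≤ a := by
      have : 4 ≤ B / ε := (le_div_iff₀ hε).2 hcase
      linarith
    have h5 : B / ε / 2 * (11 * ε) ≤ a * (V - Q) :=
      mul_le_mul h4 (by linarith) (by positivity) ha0
    have h6 : B / ε / 2 * (11 * ε) = 11 / 2 * B := by field_simp
    nlinarith
  · have h2 := hvlog 0
    rw [Real.exp_zero] at h2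
    have h3 : (N : ℝ) ≤ Real.exp 1 * (B - Q ^ 2) := by
      rw [hB]
      have : Real.exp 1 * (Q ^ 2 + N * Real.exp (-1) - Q ^ 2)
        = N * (Real.exp (-1) * Real.exp 1) := by ring
      rw [this, he, mul_one]
    have h4 : 0 ≤ a * (V - Q) := mul_nonneg ha0 (by linarith)
    have h5 : V ≤ Q ^ 2 + N := by linarith
    have h6 : Q ^ 2 + N ≤ 2.7182818286 * B := by
      have : 0 ≤ B - Q ^ 2 := by rw [hB]; simp; positivity
      nlinarith [sq_nonneg Q]
    linarith

/-- The `ℓ¹`-norm enters with weight `α ^ (2-L)`, while the correction `L/2 ∑ z i ^ 2` does not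
depend on `α` and is controlled by `t ^ 2 ≤ 1 + t ^ L`. -/
theorem sum_le_of_totalPotential_le {N L : ℕ} (hN : 0 < N) (hL : 2 < L) {w v : Fin N → ℝ}
    (hw : ∀ i, 0 ≤ w i) (hv : ∀ i, 0 ≤ v i) {ε α : ℝ} (hε : 0 < ε) (hα : 0 < α)
    (h : α ≤ initThreshold N L (∑ i, w i ^ L) ε)
    (hle : totalPotential L v (fun _ => α) ≤ totalPotential L w (fun _ => α)) :
    ∑ i, v i ^ L ≤ ∑ i, w i ^ L + ε := by
  have hL' : (0 : ℝ) < (L : ℝ) - 2 := by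
    have : (2 : ℝ) < L := by exact_mod_cast hL
    linarith
  have hL0 : (0 : ℝ) < L := by linarith
  set β := (α ^ (L - 2))⁻¹ with hβ
  have hpot : ∀ z : Fin N → ℝ, (∀ i, 0 ≤ z i) →
      ((L : ℝ) - 2) * totalPotential L z (fun _ => α) =
        N * (((L : ℝ) - 2) * α ^ 2 / 2) + β * ∑ i, z i ^ L - L / 2 * ∑ i, z i ^ 2 := by
    intro z hz
    have hc : (N : ℝ) * (((L : ℝ) - 2) * α ^ 2 / 2)
      = ∑ _i : Fin N, ((L : ℝ) - 2) * α ^ 2 / 2 := by simp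
    rw [hc, totalPotential, Finset.mul_sum, Finset.mul_sum, Finset.mul_sum,
      ← Finset.sum_add_distrib, ← Finset.sum_sub_distrib]
    refine Finset.sum_congr rfl fun i _ => ?_
    simp only [potential, barrier, if_neg hL.ne', ← hβ]
    have h2 : z i ^ L * (z i ^ (L - 2))⁻¹ = z i ^ 2 := by
      rcases (hz i).eq_or_lt with h0 | h0
      · rw [← h0, zero_pow (by omega), zero_pow two_ne_zero, zero_mul]
      · rw [mul_inv_eq_iff_eq_mul₀ (by positivity), ← pow_add]
        congr 1; omega
    have h3 : ((L : ℝ) - 2) * ((α ^ 2 - z i ^ 2) / 2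
        + z i ^ L * (β / ((L : ℝ) - 2) - (z i ^ (L - 2))⁻¹ / ((L : ℝ) - 2)))
        = ((L : ℝ) - 2) * (α ^ 2 - z i ^ 2) / 2 + z i ^ L * β
          - z i ^ L * (z i ^ (L - 2))⁻¹ := by
      rw [← sub_div]
      field_simp
      generalize (z i ^ (L - 2))⁻¹ = γ
      ring
    rw [h3, h2]
    ring
  have h1 := mul_le_mul_of_nonneg_left hle hL'.le
  rw [hpot v hv, hpot w hw] at h1
  have hw2 : 0 ≤ ∑ i, w i ^ 2 := Finset.sum_nonneg fun i _ => sq_nonneg _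
  have hv2 : ∑ i, v i ^ 2 ≤ N + ∑ i, v i ^ L := by
    have hc : (N : ℝ) = ∑ _i : Fin N, (1 : ℝ) := by simp
    rw [hc, ← Finset.sum_add_distrib]
    refine Finset.sum_le_sum fun i _ => ?_
    rcases le_total (v i) 1 with h2 | h2
    · have := pow_le_one₀ (hv i) h2 (n := 2)
      have := pow_nonneg (hv i) L
      linarith
    · have := pow_le_pow_right₀ h2 hL.le
      linarith
  have hQ0 : 0 ≤ ∑ i, w i ^ L := Finset.sum_nonneg fun i _ => pow_nonneg (hw i) _
  set Q := ∑ i, w i ^ L with hQ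
  set V := ∑ i, v i ^ L with hV
  have hN' : (0 : ℝ) < N := by exact_mod_cast hN
  have hαpow : α ^ (L - 2) ≤ 2 * ε / (L * (Q + N + ε)) := by
    rw [initThreshold, if_neg hL.ne'] at h
    have h2 := pow_le_pow_left₀ hα.le h (L - 2)
    have h3 : (1 / ((L : ℝ) - 2)) = ((L - 2 : ℕ) : ℝ)⁻¹ := by
      rw [Nat.cast_sub hL.le, one_div]; norm_num
    rwa [h3, Real.rpow_inv_natCast_pow (by positivity) (by omega)] at h2
  have hβ1 : L * (Q + N + ε) / (2 * ε) ≤ β := by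
    rw [hβ, ← inv_div]
    exact inv_anti₀ (by positivity) hαpow
  by_contra! hcon
  -- After cancelling `L / 2` this reads `(Q + N + ε)(V - Q) ≤ ε (N + V)`, that is `(Q + N)(V - Q) ≤
  -- ε (Q + N)`, and `Q + N > 0`.
  have h4 : L * (Q + N + ε) / (2 * ε) * (V - Q) ≤ L / 2 * (N + V) := by
    refine (mul_le_mul_of_nonneg_right hβ1 (by linarith)).trans ?_
    nlinarith
  have h5 : L * (Q + N + ε) / (2 * ε) * (V - Q) = L / 2 * ((Q + N + ε) * (V - Q) / ε) := by
    field_simp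
  rw [h5] at h4
  have h6 := le_of_mul_le_mul_left h4 (by positivity)
  rw [div_le_iff₀ hε] at h6
  nlinarith

/-! ### Consequences of the null space property -/

theorem restrictTo_apply {N : ℕ} (S : Finset (Fin N)) (x : EuclideanSpace ℝ (Fin N)) (i : Fin N) :
    restrictTo S x i = if i ∈ S then x i else 0 := rfl

theorem l1Norm_restrictTo {N : ℕ} (S : Finset (Fin N)) (x : EuclideanSpace ℝ (Fin N)) :
    l1Norm (restrictTo S x) = ∑ i ∈ S, |x i| := by
  simp [l1Norm, restrictTo_apply, apply_ite abs, Finset.sum_ite_mem]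

theorem norm_sq_restrictTo {N : ℕ} (S : Finset (Fin N)) (x : EuclideanSpace ℝ (Fin N)) :
    ‖restrictTo S x‖ ^ 2 = ∑ i ∈ S, x i ^ 2 := by
  simp [EuclideanSpace.norm_sq_eq, restrictTo_apply, ite_pow, Finset.sum_ite_mem]

theorem l1Norm_nonneg {N : ℕ} (x : EuclideanSpace ℝ (Fin N)) : 0 ≤ l1Norm x :=
  Finset.sum_nonneg fun _ _ => abs_nonneg _

theorem l1Norm_eq_sum_add_sum_compl {N : ℕ} (S : Finset (Fin N)) (x : EuclideanSpace ℝ (Fin N)) :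
    l1Norm x = ∑ i ∈ S, |x i| + ∑ i ∈ Sᶜ, |x i| :=
  (Finset.sum_add_sum_compl S _).symm

theorem restrictTo_add_restrictTo_compl {N : ℕ} (S : Finset (Fin N))
    (x : EuclideanSpace ℝ (Fin N)) : restrictTo S x + restrictTo Sᶜ x = x := by
  ext i
  by_cases h : i ∈ S <;> simp [restrictTo_apply, h]

/-- The `ℓ¹` null space property on the kernel of `A`. -/
theorem L2RobustNSP.sum_abs_le {M N s : ℕ} {A : Matrix (Fin M) (Fin N) ℝ} {ρ τ : ℝ}
    (h : L2RobustNSP A s ρ τ) (hs : 1 ≤ s) {S : Finset (Fin N)}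
    (hS : S.card ≤ s) {v : EuclideanSpace ℝ (Fin N)} (hv : matVec A v = 0) :
    ∑ i ∈ S, |v i| ≤ ρ * ∑ i ∈ Sᶜ, |v i| := by
  have h1 := h S hS v
  rw [hv, norm_zero, mul_zero, add_zero, l1Norm_restrictTo] at h1
  have hs0 : 0 < Real.sqrt s := Real.sqrt_pos.2 (by exact_mod_cast hs)
  have h2 : ∑ i ∈ S, |v i| ≤ Real.sqrt s * ‖restrictTo S v‖ := by
    refine abs_le_of_sq_le_sq' ?_ (by positivity) |>.2
    rw [mul_pow, norm_sq_restrictTo, Real.sq_sqrt (Nat.cast_nonneg _)]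
    have h3 := sq_sum_le_card_mul_sum_sq (s := S) (f := fun i => |v i|)
    simp only [sq_abs] at h3
    refine h3.trans (mul_le_mul_of_nonneg_right (by exact_mod_cast hS) ?_)
    exact Finset.sum_nonneg fun i _ => sq_nonneg _
  refine h2.trans ((mul_le_mul_of_nonneg_left h1 hs0.le).trans_eq ?_)
  field_simp

theorem L2RobustNSP.norm_le {M N s : ℕ} {A : Matrix (Fin M) (Fin N) ℝ} {ρ τ : ℝ}
    (h : L2RobustNSP A s ρ τ) (hρ : 0 ≤ ρ) (hs : 1 ≤ s)
    {v : EuclideanSpace ℝ (Fin N)} (hv : matVec A v = 0) :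
    ‖v‖ ≤ (1 + ρ) / Real.sqrt s * l1Norm v := by
  have hs0 : (0 : ℝ) < s := by exact_mod_cast hs
  have hsq : 0 < Real.sqrt s := Real.sqrt_pos.2 hs0
  have hn := l1Norm_nonneg v
  -- Thresholding at `‖v‖₁ / s` replaces sorting: at most `s` entries exceed it, and the others have
  -- squared sum at most `‖v‖₁ ^ 2 / s`.
  set S : Finset (Fin N) := Finset.univ.filter fun i => l1Norm v / s < |v i| with hSdef
  have hS : S.card ≤ s := by
    by_contra hlt
    rw [not_le] at hlt
    have hne : S.Nonempty := Finset.card_pos.1 (by omega)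
    have h1 : S.card • (l1Norm v / s) < ∑ i ∈ S, |v i| := by
      rw [← Finset.sum_const]
      exact Finset.sum_lt_sum_of_nonempty hne fun i hi => (Finset.mem_filter.1 hi).2
    have h2 : ∑ i ∈ S, |v i| ≤ l1Norm v :=
      Finset.sum_le_univ_sum_of_nonneg fun i => abs_nonneg _
    have h3 : (s : ℝ) ≤ S.card := by exact_mod_cast hlt.le
    have h4 := mul_le_mul_of_nonneg_right h3 (div_nonneg hn hs0.le)
    rw [nsmul_eq_mul] at h1
    rw [mul_div_cancel₀ _ hs0.ne'] at h4
    linarith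
  have hA := h S hS v
  rw [hv, norm_zero, mul_zero, add_zero, l1Norm_restrictTo] at hA
  have hcompl : ∑ i ∈ Sᶜ, |v i| ≤ l1Norm v :=
    Finset.sum_le_univ_sum_of_nonneg fun i => abs_nonneg _
  have hB : ‖restrictTo Sᶜ v‖ ≤ 1 / Real.sqrt s * l1Norm v := by
    refine abs_le_of_sq_le_sq' ?_ (by positivity) |>.2
    rw [norm_sq_restrictTo, mul_pow, div_pow, one_pow, Real.sq_sqrt hs0.le]
    calc ∑ i ∈ Sᶜ, v i ^ 2 ≤ ∑ i ∈ Sᶜ, l1Norm v / s * |v i| := by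
          refine Finset.sum_le_sum fun i hi => ?_
          have h1 : |v i| ≤ l1Norm v / s := by simpa [hSdef] using hi
          rw [← sq_abs, sq]
          exact mul_le_mul_of_nonneg_right h1 (abs_nonneg _)
      _ = l1Norm v / s * ∑ i ∈ Sᶜ, |v i| := by rw [Finset.mul_sum]
      _ ≤ l1Norm v / s * l1Norm v := mul_le_mul_of_nonneg_left hcompl (by positivity)
      _ = 1 / s * l1Norm v ^ 2 := by ring
  calc ‖v‖ = ‖restrictTo S v + restrictTo Sᶜ v‖ := by rw [restrictTo_add_restrictTo_compl]
    _ ≤ ‖restrictTo S v‖ + ‖restrictTo Sᶜ v‖ := norm_add_le _ _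
    _ ≤ ρ / Real.sqrt s * l1Norm v + 1 / Real.sqrt s * l1Norm v :=
        add_le_add (hA.trans (mul_le_mul_of_nonneg_left hcompl (by positivity))) hB
    _ = (1 + ρ) / Real.sqrt s * l1Norm v := by ring

theorem L2RobustNSP.l1Norm_sub_le {M N s : ℕ} {A : Matrix (Fin M) (Fin N) ℝ} {ρ τ : ℝ}
    (h : L2RobustNSP A s ρ τ) (hρ : 0 ≤ ρ) (hs : 1 ≤ s)
    {x z : EuclideanSpace ℝ (Fin N)} (hxz : matVec A z = matVec A x) :
    (1 - ρ) / (1 + ρ) * l1Norm (z - x) ≤ l1Norm z - l1Norm x + 2 * bestTermError s x := by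
  have hv : matVec A (z - x) = 0 := by rw [matVec_sub, hxz, sub_self]
  suffices hB : ((1 - ρ) / (1 + ρ) * l1Norm (z - x) - (l1Norm z - l1Norm x)) / 2
      ≤ bestTermError s x by linarith
  -- The estimate is proved against every sparse `w`, with `S` its support, so no best approximation
  -- has to exist.
  refine le_csInf ⟨_, 0, by simp [IsSparse], rfl⟩ ?_
  rintro r ⟨w, hw, rfl⟩
  set S : Finset (Fin N) := Finset.univ.filter fun i => w i ≠ 0 with hSdef
  have hS : S.card ≤ s := by
    refine le_trans (le_of_eq ?_) hw
    rw [← Set.ncard_coe_finset]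
    congr 1
    ext i; simp [hSdef]
  have h1 := h.sum_abs_le hs hS hv
  have h2 : ∑ i ∈ Sᶜ, |x i| ≤ l1Norm (x - w) := by
    rw [l1Norm_eq_sum_add_sum_compl S]
    have h3 : ∑ i ∈ Sᶜ, |(x - w) i| = ∑ i ∈ Sᶜ, |x i| := by
      refine Finset.sum_congr rfl fun i hi => ?_
      have : w i = 0 := by simpa [hSdef] using hi
      simp [this]
    rw [h3]
    have : 0 ≤ ∑ i ∈ S, |(x - w) i| := Finset.sum_nonneg fun _ _ => abs_nonneg _
    linarith
  have h4 : ∑ i ∈ S, |x i| - ∑ i ∈ S, |(z - x) i| ≤ ∑ i ∈ S, |z i| := by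
    rw [← Finset.sum_sub_distrib]
    refine Finset.sum_le_sum fun i _ => ?_
    have := abs_sub_abs_le_abs_sub (x i) (z i)
    rw [PiLp.sub_apply, abs_sub_comm (z i)]
    linarith
  have h5 : ∑ i ∈ Sᶜ, |(z - x) i| - ∑ i ∈ Sᶜ, |x i| ≤ ∑ i ∈ Sᶜ, |z i| := by
    rw [← Finset.sum_sub_distrib]
    refine Finset.sum_le_sum fun i _ => ?_
    have := abs_sub (z i) (x i)
    rw [PiLp.sub_apply]
    linarith
  have hz := l1Norm_eq_sum_add_sum_compl S z
  have hx := l1Norm_eq_sum_add_sum_compl S x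
  have hzx := l1Norm_eq_sum_add_sum_compl S (z - x)
  set a := ∑ i ∈ S, |(z - x) i|
  set b := ∑ i ∈ Sᶜ, |(z - x) i|
  -- After clearing denominators this is exactly `a ≤ ρ b`.
  have h6 : (1 - ρ) / (1 + ρ) * l1Norm (z - x) ≤ b - a := by
    rw [hzx, div_mul_eq_mul_div, div_le_iff₀ (by linarith)]
    nlinarith
  linarith

/-- Stable recovery: the `ℓ²`-distance of two vectors with the same image under `A`. -/
theorem L2RobustNSP.norm_sub_le {M N s : ℕ} {A : Matrix (Fin M) (Fin N) ℝ} {ρ τ : ℝ}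
    (h : L2RobustNSP A s ρ τ) (hρ : 0 ≤ ρ) (hρ₁ : ρ < 1) (hs : 1 ≤ s)
    {x z : EuclideanSpace ℝ (Fin N)} (hxz : matVec A z = matVec A x) :
    ‖z - x‖ ≤ (1 + ρ) ^ 2 / (1 - ρ) / Real.sqrt s *
      (l1Norm z - l1Norm x + 2 * bestTermError s x) := by
  have hs0 : (0 : ℝ) < s := by exact_mod_cast hs
  have hsq : 0 < Real.sqrt s := Real.sqrt_pos.2 hs0
  have h1 : 0 < 1 - ρ := by linarith
  have h2 : 0 < 1 + ρ := by linarith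
  refine (h.norm_le hρ hs (by rw [matVec_sub, hxz, sub_self])).trans ?_
  refine le_trans (le_of_eq ?_) (mul_le_mul_of_nonneg_left (h.l1Norm_sub_le hρ hs hxz)
    (by positivity))
  field_simp

/-! ### Reduction to one factor and conclusion -/

theorem IsGradientFlow.exists_reducedFlow {M N L : ℕ} {A : Matrix (Fin M) (Fin N) ℝ}
    {y : EuclideanSpace ℝ (Fin M)} {α : ℝ} (hα : 0 < α) (hL : 2 ≤ L)
    {x : ℝ → Fin L → EuclideanSpace ℝ (Fin N)} (h : IsGradientFlow A y (constVec N α) x) :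
    ∃ u : ℝ → Fin N → ℝ, IsReducedFlow L A y u ∧ u 0 = (fun _ => α) ∧
      ∀ t, 0 ≤ t → hadamardProd (x t) = powVec L (u t) := by
  set k : Fin L := ⟨0, by omega⟩
  have hprod : ∀ t, 0 ≤ t → hadamardProd (x t) = powVec L (fun i => x t k i) := by
    intro t ht
    ext i
    rw [hadamardProd_apply, Finset.prod_congr rfl fun j _ => (h.pos_and_eq hα hL i ht).2 j k]
    simp [powVec]
  refine ⟨fun t i => x t k i, ⟨fun t ht i => (h.pos_and_eq hα hL i ht).1 k, fun t ht i => ?_⟩,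
    ?_, hprod⟩
  · have h1 := h.hasDerivWithinAt_coord k i ht
    rw [hprod t ht, Finset.prod_congr rfl fun j _ => (h.pos_and_eq hα hL i ht).2 j k,
      Finset.prod_const, Finset.card_erase_of_mem (Finset.mem_univ k), Finset.card_univ,
      Fintype.card_fin] at h1
    exact h1
  · ext i
    show x 0 k i = α
    rw [h.1 k]
    rfl

theorem l1Norm_powVec {N : ℕ} (L : ℕ) {w : Fin N → ℝ} (hw : ∀ i, 0 ≤ w i) :
    l1Norm (powVec L w) = ∑ i, w i ^ L :=
  Finset.sum_congr rfl fun i _ => abs_of_nonneg (pow_nonneg (hw i) L)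

theorem bestTermError_nonneg {N : ℕ} (s : ℕ) (x : EuclideanSpace ℝ (Fin N)) :
    0 ≤ bestTermError s x :=
  Real.sInf_nonneg (by rintro _ ⟨z, -, rfl⟩; exact l1Norm_nonneg _)

theorem theorem3 (ρ τ c d : ℝ) (hρ₀ : 0 ≤ ρ) (hρ₁ : ρ < 1) (hτ : 0 < τ) (hc : 0 < c)
    (hd : 0 < d) :
    ∃ C : ℝ, 0 < C ∧
      ∀ (M N L s : ℕ) (A : Matrix (Fin M) (Fin N) ℝ),
        2 ≤ L → 1 ≤ s → s = ⌊c * sparsityScale M N⌋₊ →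
        L2RobustNSP A s ρ τ → L1QuotientProperty A d →
        ∀ (xStar xPos xNeg : EuclideanSpace ℝ (Fin N)) (y yPos : EuclideanSpace ℝ (Fin M)),
          y = matVec A xStar →
          IsEuclideanProjection (nonnegImage A) y yPos →
          xStar = xPos - xNeg → (∀ i, 0 ≤ xPos i) → matVec A xPos = yPos →
          ∀ (ε α : ℝ), 0 < ε → 0 < α → α ≤ initThreshold N L (l1Norm xPos) ε →
          ∀ x : ℝ → Fin L → EuclideanSpace ℝ (Fin N),
            IsGradientFlow A y (constVec N α) x →
            ∃ xInf : EuclideanSpace ℝ (Fin N),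
              Tendsto (fun t => hadamardProd (x t)) atTop (𝓝 xInf) ∧
              ‖xInf - xStar‖ ≤
                C / Real.sqrt s * (2 * bestTermError s xPos + ε) + ‖xNeg‖ := by
  have h1ρ : 0 < 1 - ρ := by linarith
  refine ⟨11 * ((1 + ρ) ^ 2 / (1 - ρ)), by positivity, ?_⟩
  rintro M N L s A hL hs hsdef hA - xStar xPos xNeg y yPos - hproj hdec hpos hAx ε α hε hα hαle
    x hx
  -- For `N = 0` the logarithm is `log 0 = 0` and division by zero gives scale `0`, so `s = 0`,
  -- contrary to `1 ≤ s`.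
  have hN : 0 < N := by
    rcases Nat.eq_zero_or_pos N with rfl | hN
    · simp [sparsityScale] at hsdef
      omega
    · exact hN
  obtain ⟨u, hu, hu0, hprod⟩ := hx.exists_reducedFlow hα hL
  obtain ⟨v, hv, hlim, hAv, hmin⟩ := hu.exists_limit hL hproj
  obtain ⟨w, hw, rfl⟩ := exists_powVec_eq hL hpos
  have hle := hmin w hw hAx
  rw [hu0] at hle
  rw [l1Norm_powVec L hw] at hαle
  have hgap : l1Norm (powVec L v) - l1Norm (powVec L w) ≤ 11 * ε := by
    rw [l1Norm_powVec L hw, l1Norm_powVec L hv]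
    rcases hL.eq_or_lt with rfl | hL
    · have := sum_le_of_totalPotential_two_le hε hα hαle hle
      linarith
    · have := sum_le_of_totalPotential_le hN hL hw hv hε hα hαle hle
      linarith
  refine ⟨powVec L v, ?_, ?_⟩
  · refine (((continuous_powVec L).tendsto v).comp hlim).congr' ?_
    filter_upwards [eventually_ge_atTop 0] with t ht
    exact (hprod t ht).symm
  · have h1 := hA.norm_sub_le hρ₀ hρ₁ hs (hAv.trans hAx.symm)
    have h2 : powVec L v - xStar = (powVec L v - powVec L w) + xNeg := by rw [hdec]; abel
    have h3 := bestTermError_nonneg s (powVec L w)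
    rw [h2]
    refine (norm_add_le _ _).trans (add_le_add_left (h1.trans ?_) _)
    calc (1 + ρ) ^ 2 / (1 - ρ) / Real.sqrt s * (l1Norm (powVec L v) - l1Norm (powVec L w)
          + 2 * bestTermError s (powVec L w))
        ≤ (1 + ρ) ^ 2 / (1 - ρ) / Real.sqrt s
          * (11 * (2 * bestTermError s (powVec L w) + ε)) :=
          mul_le_mul_of_nonneg_left (by linarith) (by positivity)
      _ = _ := by ring
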